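/- Let $f$ be analytic in the unit disc $\mathbb D$, let $M(r,f)=\max_{|z|=r}|f(z)|$, and let $$\sigma_M=\limsup_{r\to1^-}\frac{\log^+\log^+M(r,f)}{\log\frac1{1-r}},\qquad \lambda_M=\liminf_{r\to1^-}\frac{\log^+\log^+M(r,f)}{\log\frac1{1-r}}$$ be its order and lower order. Assume $0\le\lambda_M<\sigma_M<\infty$, and let $\eta\in(0,\sigma_M-\lambda_M)$ and $\varepsilon>0$. Let $\lambda:[0,1)\to(0,\infty)$ be a quasi proximate order of $f$ related to $\eta$; that is, there is an associated function $A^*:[0,1)\to(0,\infty)$ such that 1. $\lambda\in C^1[0,1)$; 2. $\limsup_{r\to1^-}\lambda(r)=\sigma_M$; 3. $\liminf_{r\to1^-}\lambda(r)=\lambda_M+\eta$; 4. $\limsup_{r\to1^-}|\lambda'(r)|(1-r)\log\frac1{1-r}<\infty$; 5. $A^*(r)\le(1-r)^{-\lambda(r)}\le(1+o(1))A^*(r)$ as $r\to1^-$; 6. $A^*$ is nondecreasing, and there is a constant $C$ with $A^*\left(\frac{1+r}2\right)\le C A^*(r)$ for all $0\le r<1$; 7. $\log M(r,f)\le(1-r)^{-\lambda(r)}$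 for all $0\le r<1$. For $0\le r<1$ let $$n_1(r,f)=\max_{\varphi\in\mathbb R}\#\left\{a: f(a)=0,\ r\le|a|\le\frac{1+r}2,\ |\arg a-\varphi|\le\frac\pi4(1-r)\right\},$$ where zeros are counted with multiplicity and arguments are taken modulo $2\pi$. Write $x^+=\max\{x,0\}$. Then there are a constant $C>0$ and $R_0\in(0,1)$ such that $$n_1(R,f)\le\frac{C}{(1-R)^{1+\lambda(R)\left(1-\frac1{\sigma_M}\right)^++\varepsilon}},\qquad R_0\le R<1.$$ Moreover, there are a measurable set $E\subset[0,1)$ of upper density one, that is, $\limsup_{r\to1^-}\frac{m(E\cap[r,1))}{1-r}=1$ with $m$ the Lebesgue measure, and a constant $C>0$ such that $$n_1(R,f)\le\frac{C}{(1-R)^{1+(\lambda_M+\eta)\left(1-\frac1{\sigma_M}\right)^++\varepsilon}},\qquad R\in E.$$ -/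

import Mathlib

open Filter Topology MeasureTheory Set
open scoped ENNReal

noncomputable section

namespace UnitDisc

/-- The maximum modulus `M(r, f) = max {|f z| : |z| = r}`. -/
def maxModulus (f : ℂ → ℂ) (r : ℝ) : ℝ :=
  sSup ((fun z => ‖f z‖) '' Metric.sphere (0 : ℂ) r)

/-- The quotient `log⁺ log⁺ M(r, f) / log (1 / (1 - r))`. -/
def growthQuotient (f : ℂ → ℂ) (r : ℝ) : ℝ :=
  Real.posLog (Real.posLog (maxModulus f r)) / Real.log (1 / (1 - r))

/-- The order `σ_M(f)`, an extended real number. -/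
def order (f : ℂ → ℂ) : EReal :=
  limsup (fun r : ℝ => (growthQuotient f r : EReal)) (𝓝[<] 1)

/-- The lower order `λ_M(f)`, an extended real number. -/
def lowerOrder (f : ℂ → ℂ) : EReal :=
  liminf (fun r : ℝ => (growthQuotient f r : EReal)) (𝓝[<] 1)

/-- `A` is an associated function of `lam`, where `lam : [0, 1) → (0, ∞)` satisfies the conditions
of a quasi proximate order, related to `η`, of the analytic function `f` in the unit disc.
Only the values of `lam` and `A` on `[0, 1)` matter. -/
structure IsQuasiProximateOrderWith (f : ℂ → ℂ) (η : ℝ) (lam A : ℝ → ℝ) : Prop where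
  lam_pos : ∀ r ∈ Ico (0 : ℝ) 1, 0 < lam r
  assoc_pos : ∀ r ∈ Ico (0 : ℝ) 1, 0 < A r
  contDiffOn : ContDiffOn ℝ 1 lam (Ico 0 1)
  limsup_eq : limsup (fun r : ℝ => (lam r : EReal)) (𝓝[<] 1) = order f
  liminf_eq : liminf (fun r : ℝ => (lam r : EReal)) (𝓝[<] 1) = lowerOrder f + (η : EReal)
  /-- `limsup |lam' r| (1 - r) log (1 / (1 - r)) < ∞` as `r → 1⁻`. -/
  limsup_deriv_lt_top :
    limsup (fun r : ℝ => ((|deriv lam r| * (1 - r) * Real.log (1 / (1 - r)) : ℝ) : EReal))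
      (𝓝[<] 1) < ⊤
  assoc_le : ∀ᶠ r in 𝓝[<] (1 : ℝ), A r ≤ 1 / (1 - r) ^ lam r
  le_assoc : ∃ δ : ℝ → ℝ, Tendsto δ (𝓝[<] 1) (𝓝 0) ∧
    ∀ᶠ r in 𝓝[<] (1 : ℝ), 1 / (1 - r) ^ lam r ≤ (1 + δ r) * A r
  assoc_mono : MonotoneOn A (Ico 0 1)
  assoc_doubling : ∃ C : ℝ, ∀ r ∈ Ico (0 : ℝ) 1, A ((1 + r) / 2) ≤ C * A r
  log_maxModulus_le : ∀ r ∈ Ico (0 : ℝ) 1, Real.log (maxModulus f r) ≤ 1 / (1 - r) ^ lam r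

/-- `lam` is a quasi proximate order, related to `η`, of the analytic function `f` in the unit
disc. -/
def IsQuasiProximateOrder (f : ℂ → ℂ) (η : ℝ) (lam : ℝ → ℝ) : Prop :=
  ∃ A : ℝ → ℝ, IsQuasiProximateOrderWith f η lam A

/-- The closed polar rectangle of the points with modulus in `[r, (1 + r) / 2]` that have an
argument at distance at most `π (1 - r) / 4` from `φ`. -/
def polarRectangle (r φ : ℝ) : Set ℂ :=
  {z | ∃ s θ : ℝ, r ≤ s ∧ s ≤ (1 + r) / 2 ∧ |θ - φ| ≤ Real.pi / 4 * (1 - r) ∧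
    z = (s : ℂ) * Complex.exp ((θ : ℂ) * Complex.I)}

/-- The number of zeros of `f` in `S`, counted with multiplicities (points where `f` does not
vanish contribute `0`). -/
def zeroCount (f : ℂ → ℂ) (S : Set ℂ) : ℝ≥0∞ :=
  ∑' z : S, ((analyticOrderAt f (z : ℂ) : ℕ∞) : ℝ≥0∞)

/-- `n₁(r, f)`, the maximal number of zeros of `f` in a polar rectangle at level `r`. -/
def maxZeroCount (f : ℂ → ℂ) (r : ℝ) : ℝ≥0∞ :=
  ⨆ φ : ℝ, zeroCount f (polarRectangle r φ)

/-- The upper density `limsup m(E ∩ [r, 1)) / (1 - r)`, as `r → 1⁻`, of `E ⊆ [0, 1)`. -/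
def upperDensity (E : Set ℝ) : ℝ≥0∞ :=
  limsup (fun r : ℝ => volume (E ∩ Ico r 1) / ENNReal.ofReal (1 - r)) (𝓝[<] 1)

end UnitDisc

end

/-! By Jensen's inequality, zeros in a disc are controlled by an upper bound of `log |f|` on a
slightly larger disc together with a lower bound at the centre. The issue is therefore a lower bound
near every direction at distance comparable to `1 - R` from the unit circle.

If `log |f| ≤ B` on a disc and `log |f| ≥ -K` at a point well inside it, then `log |f|` cannot be
very negative on a whole boundary arc (`exists_norm_ge_near_boundary`). Moving in this way from
depth `s` to depth `s δ` turns `K` into a multiple of `(K + B) / δ`. A number `N` of steps depending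
only on `ε`, with `δ` about `(1 - R) ^ (1 / N)`, keeps the accumulated constants bounded. The cost
is about `(1 - R)⁻¹ (1 - R) ^ (-1 / N)` times the largest product of a depth `s` and the upper bound
there. That upper bound is a multiple of both `s ^ (-σ)`, with `σ` slightly above the order, and `T
= (1 - R) ^ (-lam R)`. Balancing the two (`mul_min_rpow_le`) produces `T ^ max (1 - 1 / σ) 0`.

For the second estimate, the derivative condition keeps `lam` almost constant on `[r, 1 - q (1 -
r))`. Starting where `lam` is near its lower limit, such intervals fill a proportion `1 - q` of `[r,
1)`. -/

namespace UnitDisc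

/-! ### Smallness on arcs and Jensen's formula -/

/-- A quantitative form of Jensen's inequality at the centre of the unit disc, for a function that
is small on an arc of the unit circle. -/
theorem log_norm_le_of_norm_le_on_arc {g : ℂ → ℂ} {a B Y : ℝ}
    (hg : AnalyticOnNhd ℂ g (Metric.closedBall 0 1)) (hg0 : g 0 ≠ 0)
    (hB : ∀ z ∈ Metric.sphere (0 : ℂ) 1, ‖g z‖ ≤ Real.exp B) (ha : 0 ≤ a)
    (ha' : a ≤ 2 * Real.pi)
    (hY : ∀ θ ∈ Icc 0 a, ‖g (circleMap 0 1 θ)‖ ≤ Real.exp (-Y)) :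
    2 * Real.pi * Real.log ‖g 0‖ ≤ -(a * Y) + (2 * Real.pi - a) * B := by
  have hg1 : AnalyticOnNhd ℂ g (Metric.closedBall 0 |1|) := by simpa using hg
  have hJ := hg1.circleAverage_log_norm one_ne_zero hg0
  have hsum : 0 ≤ ∑ᶠ u, (MeromorphicOn.divisor g (Metric.closedBall 0 |1|) u : ℝ) *
      Real.log (1 * ‖0 - u‖⁻¹) := by
    refine finsum_nonneg fun u => ?_
    by_cases hu : u ∈ Metric.closedBall (0 : ℂ) |1|
    · refine mul_nonneg (by exact_mod_cast MeromorphicOn.AnalyticOnNhd.divisor_nonneg hg1 u) ?_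
      -- At `u = 0` the logarithmic factor is `0`, by the conventions `0⁻¹ = 0` and `log 0 = 0`.
      rcases eq_or_ne u 0 with rfl | hu0
      · simp
      · refine Real.log_nonneg ?_
        simp only [zero_sub, norm_neg, one_mul]
        exact (one_le_inv₀ (norm_pos_iff.2 hu0)).2 (by simpa using hu)
    · simp [Function.locallyFinsuppWithin.apply_eq_zero_of_notMem _ hu]
  -- Since `log 0 = 0`, the pointwise bounds may fail at zeros on the circle; these form a null set
  -- of angles.
  have hcod : {z : ℂ | g z ≠ 0} ∈ codiscreteWithin (Metric.sphere (0 : ℂ) |1|) := by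
    have h := hg.preimage_zero_mem_codiscreteWithin hg0 (by simp)
      ((convex_closedBall (0 : ℂ) 1).isConnected ⟨0, by simp⟩)
    exact codiscreteWithin_mono (by simpa using Metric.sphere_subset_closedBall) h
  have hae : ∀ᵐ θ : ℝ, g (circleMap 0 1 θ) ≠ 0 := by
    have h1 := circleMap_preimage_codiscrete (c := 0) (R := 1) one_ne_zero hcod
    have h2 := ae_restrict_le_codiscreteWithin (μ := (volume : Measure ℝ)) MeasurableSet.univ h1
    rw [Measure.restrict_univ] at h2
    exact h2
  have hint : CircleIntegrable (fun z => Real.log ‖g z‖) 0 1 :=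
    MeromorphicOn.circleIntegrable_log_norm
      (hg1.meromorphicOn.mono_set Metric.sphere_subset_closedBall)
  have hint' : IntervalIntegrable (fun θ => Real.log ‖g (circleMap 0 1 θ)‖) volume 0
      (2 * Real.pi) := hint
  have hi1 : IntervalIntegrable (fun θ => Real.log ‖g (circleMap 0 1 θ)‖) volume 0 a :=
    hint'.mono_set (by
      rw [uIcc_of_le ha, uIcc_of_le (by positivity)]; exact Icc_subset_Icc le_rfl ha')
  have hi2 : IntervalIntegrable (fun θ => Real.log ‖g (circleMap 0 1 θ)‖) volume a
      (2 * Real.pi) :=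
    hint'.mono_set (by
      rw [uIcc_of_le ha', uIcc_of_le (by positivity)]; exact Icc_subset_Icc ha le_rfl)
  have e1 : ∫ θ in (0 : ℝ)..a, Real.log ‖g (circleMap 0 1 θ)‖ ≤ ∫ θ in (0 : ℝ)..a, -Y := by
    refine intervalIntegral.integral_mono_ae_restrict ha hi1 (by simp) ?_
    filter_upwards [ae_restrict_of_ae hae, ae_restrict_mem measurableSet_Icc] with θ h0 hθ
    exact (Real.log_le_iff_le_exp (norm_pos_iff.2 h0)).2 (hY θ hθ)
  have e2 : ∫ θ in a..(2 * Real.pi), Real.log ‖g (circleMap 0 1 θ)‖ ≤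
      ∫ θ in a..(2 * Real.pi), B := by
    refine intervalIntegral.integral_mono_ae_restrict ha' hi2 (by simp) ?_
    filter_upwards [ae_restrict_of_ae hae] with θ h0
    exact (Real.log_le_iff_le_exp (norm_pos_iff.2 h0)).2 (hB _ (by simp))
  have e3 := intervalIntegral.integral_add_adjacent_intervals hi1 hi2
  simp only [intervalIntegral.integral_const, smul_eq_mul] at e1 e2
  rw [Real.circleAverage_def, smul_eq_mul] at hJ
  have hJ' : ∫ θ in (0 : ℝ)..(2 * Real.pi), Real.log ‖g (circleMap 0 1 θ)‖ =
      2 * Real.pi * (∑ᶠ u, (MeromorphicOn.divisor g (Metric.closedBall 0 |1|) u : ℝ) *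
      Real.log (1 * ‖0 - u‖⁻¹) + Real.log ‖g 0‖) := by
    rw [← hJ]; field_simp
  have := mul_nonneg Real.two_pi_pos.le hsum
  nlinarith

theorem one_sub_norm_le_norm_one_add_conj_mul {b v : ℂ} (hv : ‖v‖ ≤ 1) :
    1 - ‖b‖ ≤ ‖1 + (starRingEnd ℂ) b * v‖ := by
  have h := norm_sub_norm_le (1 : ℂ) (-((starRingEnd ℂ) b * v))
  rw [norm_neg, norm_mul, RCLike.norm_conj, norm_one, sub_neg_eq_add] at h
  nlinarith [norm_nonneg b]

theorem norm_add_div_one_add_conj_mul_le_one {b v : ℂ} (hb : ‖b‖ < 1) (hv : ‖v‖ ≤ 1) :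
    ‖(v + b) / (1 + (starRingEnd ℂ) b * v)‖ ≤ 1 := by
  have h0 : 0 < ‖1 + (starRingEnd ℂ) b * v‖ :=
    (sub_pos.2 hb).trans_le (one_sub_norm_le_norm_one_add_conj_mul hv)
  rw [norm_div, div_le_one h0]
  refine (sq_le_sq₀ (norm_nonneg _) h0.le).1 ?_
  have hb2 : ‖b‖ ^ 2 ≤ 1 := by nlinarith [norm_nonneg b]
  have hv2 : ‖v‖ ^ 2 ≤ 1 := by nlinarith [norm_nonneg v]
  simp only [← Complex.normSq_eq_norm_sq, Complex.normSq_apply] at hb2 hv2 ⊢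
  simp only [Complex.add_re, Complex.add_im, Complex.mul_re, Complex.mul_im, Complex.conj_re,
    Complex.conj_im, Complex.one_re, Complex.one_im]
  nlinarith [mul_nonneg (sub_nonneg.2 hb2) (sub_nonneg.2 hv2)]

/-- If an analytic function is bounded above on a disc and bounded below at a point well inside the
disc, it is bounded below somewhere on each arc of the boundary. -/
theorem exists_norm_ge_near_boundary {f : ℂ → ℂ} {C c ζ : ℂ} {ρ B K a : ℝ} (hρ : 0 < ρ)
    (hf : AnalyticOnNhd ℂ f (Metric.closedBall C ρ))
    (hB : ∀ z ∈ Metric.closedBall C ρ, ‖f z‖ ≤ Real.exp B) (hc : ‖c - C‖ ≤ ρ / 2)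
    (hfc : Real.exp (-K) ≤ ‖f c‖) (hB0 : 0 ≤ B) (hKB : 0 < K + B) (hζ : ‖ζ‖ = 1) (ha : 0 < a)
    (ha1 : a ≤ 1) :
    ∃ w, ‖w - (C + ρ * ζ)‖ ≤ 4 * ρ * a ∧ Real.exp (-(7 / a * (K + B))) ≤ ‖f w‖ := by
  have hρ' : (ρ : ℂ) ≠ 0 := by exact_mod_cast hρ.ne'
  obtain ⟨b, hb⟩ : ∃ b : ℂ, b = (c - C) / ρ := ⟨_, rfl⟩
  have hbn : ‖b‖ ≤ 1 / 2 := by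
    rw [hb, norm_div, Complex.norm_real, Real.norm_of_nonneg hρ.le, div_le_iff₀ hρ]; linarith
  have hb1 : ‖b‖ < 1 := by linarith
  have hne : ∀ v : ℂ, ‖v‖ ≤ 1 → 1 + (starRingEnd ℂ) b * v ≠ 0 := fun v hv =>
    norm_pos_iff.1 (by linarith [one_sub_norm_le_norm_one_add_conj_mul (b := b) hv])
  -- The Möbius map `m` moves the centre to `b`, the normalised position of `c`, and `ξ` is the
  -- preimage of `ζ`. Thus `u ↦ f (C + ρ m (ξ u))` takes the value `f c` at `0`, and the arc of
  -- angles `[0, a]` starts over `ζ`.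
  obtain ⟨m, hm⟩ : ∃ m : ℂ → ℂ, m = fun v => (v + b) / (1 + (starRingEnd ℂ) b * v) := ⟨_, rfl⟩
  obtain ⟨ξ, hξ⟩ : ∃ ξ : ℂ, ξ = (ζ - b) / (1 - (starRingEnd ℂ) b * ζ) := ⟨_, rfl⟩
  have hζne : 1 - (starRingEnd ℂ) b * ζ ≠ 0 := by
    have := hne (-ζ) (by simp [hζ])
    rwa [mul_neg, ← sub_eq_add_neg] at this
  have hξ1 : ‖ξ‖ ≤ 1 := by
    have := norm_add_div_one_add_conj_mul_le_one (b := -b) (v := ζ) (by simpa using hb1) hζ.le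
    rw [hξ]; simpa [sub_eq_add_neg] using this
  have hmξ : m ξ = ζ := by
    have h1 := hne ξ hξ1
    have h2 : ξ * (1 - (starRingEnd ℂ) b * ζ) = ζ - b := by rw [hξ, div_mul_cancel₀ _ hζne]
    simp only [hm]
    rw [div_eq_iff h1]
    linear_combination h2
  have hmball : ∀ v : ℂ, ‖v‖ ≤ 1 → C + ρ * m v ∈ Metric.closedBall C ρ := by
    intro v hv
    have := norm_add_div_one_add_conj_mul_le_one hb1 hv
    rw [mem_closedBall_iff_norm, add_sub_cancel_left, norm_mul, Complex.norm_real,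
      Real.norm_of_nonneg hρ.le, hm]
    nlinarith
  have hξu : ∀ u : ℂ, ‖u‖ ≤ 1 → ‖ξ * u‖ ≤ 1 := fun u hu => by
    rw [norm_mul]; exact mul_le_one₀ hξ1 (norm_nonneg _) hu
  have hana : AnalyticOnNhd ℂ (fun u => f (C + ρ * m (ξ * u))) (Metric.closedBall 0 1) := by
    intro u hu
    have hu' : ‖u‖ ≤ 1 := by simpa using hu
    have h1 := hne _ (hξu u hu')
    refine AnalyticAt.fun_comp (g := f) (hf _ (hmball _ (hξu u hu'))) ?_
    rw [hm]
    refine analyticAt_const.add (analyticAt_const.mul (AnalyticAt.div ?_ ?_ h1))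
    · fun_prop
    · fun_prop
  have hm0 : C + ρ * m (ξ * 0) = c := by simp only [hm, hb]; field_simp; simp
  by_contra! hcon
  -- Here `a Y = 7 (K + B)`, so smallness on the arc would force `7 (K + B) ≤ 2π (K + B)`.
  have key := log_norm_le_of_norm_le_on_arc (g := fun u => f (C + ρ * m (ξ * u))) (a := a)
    (B := B) (Y := 7 / a * (K + B)) hana ?_ ?_ ha.le (by linarith [Real.pi_gt_three]) ?_
  · simp only [hm0] at key
    have hlog : -K ≤ Real.log ‖f c‖ := (Real.le_log_iff_exp_le ((Real.exp_pos _).trans_le hfc)).2 hfc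
    have h7 : a * (7 / a * (K + B)) = 7 * (K + B) := by field_simp
    rw [h7] at key
    have hp : 2 * Real.pi < 7 := by linarith [Real.pi_lt_d2]
    have h8 : 2 * Real.pi * (-K) ≤ 2 * Real.pi * Real.log ‖f c‖ :=
      mul_le_mul_of_nonneg_left hlog Real.two_pi_pos.le
    nlinarith
  · simp only [hm0]
    exact norm_pos_iff.1 ((Real.exp_pos _).trans_le hfc)
  · intro z hz
    exact hB _ (hmball _ (hξu z (by simpa using (mem_sphere_zero_iff_norm.1 hz).le)))
  · intro θ hθ
    refine (hcon _ ?_).le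
    have hu : ‖circleMap 0 1 θ‖ ≤ 1 := by simp
    have d1 := one_sub_norm_le_norm_one_add_conj_mul (b := b) (hξu _ hu)
    have d2 := one_sub_norm_le_norm_one_add_conj_mul (b := b) hξ1
    have n1 := hne _ (hξu _ hu)
    have n2 := hne _ hξ1
    have hθ1 : ‖circleMap 0 1 θ - 1‖ ≤ a := by
      have := Real.norm_exp_I_mul_ofReal_sub_one_le (x := θ)
      rw [Real.norm_of_nonneg hθ.1] at this
      rw [circleMap_zero, Complex.ofReal_one, one_mul, mul_comm]
      exact this.trans hθ.2
    -- Exact difference of two Möbius values. As `‖b‖ ≤ 1 / 2`, both denominators are at least `1 /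
    -- 2`, whence the factor 4 in the distance bound.
    have heq : C + ρ * m (ξ * circleMap 0 1 θ) - (C + ρ * ζ) =
        ρ * (ξ * (circleMap 0 1 θ - 1) * (1 - (starRingEnd ℂ) b * b)) /
          ((1 + (starRingEnd ℂ) b * (ξ * circleMap 0 1 θ)) * (1 + (starRingEnd ℂ) b * ξ)) := by
      rw [← hmξ]
      simp only [hm]
      rw [add_sub_add_left_eq_sub, ← mul_sub, div_sub_div _ _ n1 n2, mul_div_assoc']
      congr 1
      ring
    have hbb : ‖1 - (starRingEnd ℂ) b * b‖ ≤ 1 := by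
      rw [mul_comm, Complex.mul_conj, Complex.normSq_eq_norm_sq, ← Complex.ofReal_one,
        ← Complex.ofReal_sub, Complex.norm_real, Real.norm_eq_abs, abs_le]
      constructor <;> nlinarith [norm_nonneg b]
    have hden : 1 / 4 ≤ ‖1 + (starRingEnd ℂ) b * (ξ * circleMap 0 1 θ)‖ *
        ‖1 + (starRingEnd ℂ) b * ξ‖ := by nlinarith
    rw [heq, norm_div, norm_mul, norm_mul, norm_mul, norm_mul, Complex.norm_real,
      Real.norm_of_nonneg hρ.le, div_le_iff₀ (by linarith)]
    have h1 : ‖ξ‖ * ‖circleMap 0 1 θ - 1‖ * ‖1 - (starRingEnd ℂ) b * b‖ ≤ 1 * a * 1 := by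
      gcongr
    calc _ ≤ ρ * (1 * a * 1) := by gcongr
      _ = 4 * ρ * a * (1 / 4) := by ring
      _ ≤ _ := by gcongr

/-! ### Jensen's bound for the number of zeros -/

theorem zeroCount_le_of_subset_closedBall {f : ℂ → ℂ} {c : ℂ} {r ρ B K : ℝ} {S : Set ℂ}
    (hr : 0 < r) (hrρ : r < ρ) (hf : AnalyticOnNhd ℂ f (Metric.closedBall c ρ))
    (hB : ∀ z ∈ Metric.closedBall c ρ, ‖f z‖ ≤ Real.exp B) (hB0 : 0 ≤ B)
    (hfc : Real.exp (-K) ≤ ‖f c‖) (hS : S ⊆ Metric.closedBall c r) :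
    zeroCount f S ≤ ENNReal.ofReal ((K + B) / Real.log (ρ / r)) := by
  have hρ : 0 < ρ := hr.trans hrρ
  have hfpos : 0 < ‖f c‖ := (Real.exp_pos _).trans_le hfc
  have hfr : AnalyticOnNhd ℂ f (Metric.closedBall c r) :=
    hf.mono (Metric.closedBall_subset_closedBall hrρ.le)
  have hJ := AnalyticOnNhd.sum_divisor_le (c := c) (r := r) (R := ρ) (M := Real.exp B) (f := f)
    (by rwa [abs_of_pos hr]) (by rwa [abs_of_pos hr, abs_of_pos hρ]) (Real.one_le_exp hB0)
    (by rwa [abs_of_pos hρ]) (norm_pos_iff.1 hfpos)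
    (fun z hz => hB z (by rw [abs_of_pos hρ] at hz; exact Metric.sphere_subset_closedBall hz))
  rw [abs_of_pos hr] at hJ
  have hlog : 0 < Real.log (ρ / r) := Real.log_pos ((one_lt_div hr).2 hrρ)
  have hJ' : ((∑ᶠ u, MeromorphicOn.divisor f (Metric.closedBall c r) u : ℤ) : ℝ) ≤
      (K + B) / Real.log (ρ / r) := by
    refine hJ.trans (div_le_div_of_nonneg_right ?_ hlog.le)
    rw [Real.log_div (Real.exp_pos _).ne' hfpos.ne', Real.log_exp]
    have := (Real.le_log_iff_exp_le hfpos).2 hfc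
    linarith
  have hfin := (MeromorphicOn.divisor f (Metric.closedBall c r)).finiteSupport
    (isCompact_closedBall c r)
  -- Since `f c ≠ 0`, no order is infinite, so the divisor records the true multiplicities.
  have hord : ∀ z ∈ Metric.closedBall c r, analyticOrderAt f z ≠ ⊤ := by
    intro z hz
    refine hfr.analyticOrderAt_ne_top_of_isPreconnected (convex_closedBall c r).isPreconnected
      (Metric.mem_closedBall_self hr.le) hz ?_
    rw [(hfr c (Metric.mem_closedBall_self hr.le)).analyticOrderAt_eq_zero.2 (norm_pos_iff.1 hfpos)]
    simp
  unfold zeroCount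
  rw [ENNReal.tsum_eq_iSup_sum]
  refine iSup_le fun s => ?_
  refine le_trans ?_ (ENNReal.ofReal_le_ofReal hJ')
  have hterm : ∀ z : S, ((analyticOrderAt f (z : ℂ) : ℕ∞) : ℝ≥0∞) =
      ENNReal.ofReal ((MeromorphicOn.divisor f (Metric.closedBall c r) (z : ℂ) : ℤ) : ℝ) := by
    intro z
    rw [MeromorphicOn.AnalyticOnNhd.divisor_apply hfr (hS z.2)]
    obtain ⟨n, hn⟩ := ENat.ne_top_iff_exists.1 (hord z (hS z.2))
    rw [← hn]
    simp
  have hnn := MeromorphicOn.AnalyticOnNhd.divisor_nonneg hfr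
  rw [Finset.sum_congr rfl fun z _ => hterm z, ← ENNReal.ofReal_sum_of_nonneg
    (fun z _ => by exact_mod_cast hnn z)]
  refine ENNReal.ofReal_le_ofReal ?_
  classical
  rw [← Int.cast_sum, Int.cast_le, finsum_eq_sum_of_support_subset
    (s := hfin.toFinset ∪ s.map (Function.Embedding.subtype _)) _
    (fun z hz => Finset.mem_coe.2 (Finset.mem_union_left _ (hfin.mem_toFinset.2 hz)))]
  refine le_trans (Finset.sum_map s (Function.Embedding.subtype _)
    (fun z => MeromorphicOn.divisor f (Metric.closedBall c r) z)).ge ?_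
  exact Finset.sum_le_sum_of_subset_of_nonneg Finset.subset_union_right fun z _ _ => hnn z

/-! ### Propagation of lower bounds towards the boundary -/

/-- For every direction `ζ` there is a point close to `(1 - s) ζ` at which `log |f| ≥ -K`. -/
def LowerBoundAtDepth (f : ℂ → ℂ) (s K : ℝ) : Prop :=
  ∀ ζ : ℂ, ‖ζ‖ = 1 → ∃ c : ℂ, ‖c - (1 - s : ℝ) * ζ‖ ≤ s / 100 ∧ Real.exp (-K) ≤ ‖f c‖

/-- At depth 1 all directions share the target point 0, and the identity theorem gives a nearby
nonzero value even if `f 0 = 0`. -/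
theorem exists_lowerBoundAtDepth_one {f : ℂ → ℂ}
    (hf : DifferentiableOn ℂ f (Metric.ball (0 : ℂ) 1)) {z₀ : ℂ} (hz₀ : z₀ ∈ Metric.ball (0 : ℂ) 1)
    (hfz₀ : f z₀ ≠ 0) : ∃ K : ℝ, 1 ≤ K ∧ LowerBoundAtDepth f 1 K := by
  have hana : AnalyticOnNhd ℂ f (Metric.ball 0 1) := hf.analyticOnNhd Metric.isOpen_ball
  obtain ⟨c, hc, hfc⟩ : ∃ c : ℂ, ‖c‖ ≤ 1 / 100 ∧ f c ≠ 0 := by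
    by_contra! hcon
    refine hfz₀ (hana.eqOn_zero_of_preconnected_of_eventuallyEq_zero
      (convex_ball (0 : ℂ) 1).isPreconnected (Metric.mem_ball_self one_pos) ?_ hz₀)
    filter_upwards [Metric.closedBall_mem_nhds (0 : ℂ) (by norm_num : (0 : ℝ) < 1 / 100)] with z hz
    exact hcon z (by simpa using hz)
  refine ⟨max 1 (-Real.log ‖f c‖), le_max_left _ _, fun ζ _ => ⟨c, by simpa using hc, ?_⟩⟩
  rw [← Real.le_log_iff_exp_le (norm_pos_iff.2 hfc)]
  linarith [le_max_right 1 (-Real.log ‖f c‖)]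

/-- The disc about `(1 - s) ζ` of radius `s (1 - δ)` touches the circle `|z| = 1 - s δ` from inside
at `(1 - s δ) ζ`. An arc parameter `a = δ / 400` makes the error `4 ρ a` at most `s δ / 100` and the
loss `7 / a = 2800 / δ`. -/
theorem LowerBoundAtDepth.step {f : ℂ → ℂ} {s δ K B : ℝ}
    (hf : DifferentiableOn ℂ f (Metric.ball (0 : ℂ) 1)) (hs : 0 < s) (hs1 : s ≤ 1) (hδ : 0 < δ)
    (hδ1 : δ ≤ 1 / 2) (hK : 1 ≤ K) (hB0 : 0 ≤ B)
    (hB : ∀ z : ℂ, ‖z‖ ≤ 1 - s * δ → ‖f z‖ ≤ Real.exp B) (h : LowerBoundAtDepth f s K) :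
    LowerBoundAtDepth f (s * δ) (2800 / δ * (K + B)) := by
  intro ζ hζ
  obtain ⟨c, hc, hfc⟩ := h ζ hζ
  have hρ : s / 2 ≤ s * (1 - δ) := by nlinarith
  have hball : ∀ z ∈ Metric.closedBall (((1 - s : ℝ) : ℂ) * ζ) (s * (1 - δ)),
      ‖z‖ ≤ 1 - s * δ := by
    intro z hz
    rw [mem_closedBall_iff_norm] at hz
    have h1 := norm_le_norm_add_norm_sub' z (((1 - s : ℝ) : ℂ) * ζ)
    rw [norm_mul, hζ, Complex.norm_real, Real.norm_of_nonneg (by linarith)] at h1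
    linarith
  have hana : AnalyticOnNhd ℂ f (Metric.ball 0 1) := hf.analyticOnNhd Metric.isOpen_ball
  obtain ⟨w, hw, hfw⟩ := exists_norm_ge_near_boundary (f := f) (C := ((1 - s : ℝ) : ℂ) * ζ) (c := c)
    (ζ := ζ) (ρ := s * (1 - δ)) (B := B) (K := K) (a := δ / 400) (by nlinarith)
    (hana.mono fun z hz => by
      rw [mem_ball_zero_iff]; nlinarith [hball z hz])
    (fun z hz => hB z (hball z hz)) (by linarith) hfc hB0 (by linarith) hζ (by linarith)
    (by linarith)
  refine ⟨w, ?_, ?_⟩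
  · have e : (((1 - s : ℝ) : ℂ) * ζ + ((s * (1 - δ) : ℝ) : ℂ) * ζ) = ((1 - s * δ : ℝ) : ℂ) * ζ := by
      push_cast; ring
    rw [e] at hw
    refine hw.trans ?_
    nlinarith [mul_pos hs hδ]
  · convert hfw using 3
    field_simp
    norm_num

/-- The hypothesis gives `B (k + 1) ≤ δ ^ (-k) (Q / δ)`, which scales like the bound already
accumulated. Each step therefore adds only one term `Q / δ` inside the bracket. -/
theorem LowerBoundAtDepth.iterate {f : ℂ → ℂ} {δ K₀ Q : ℝ} {B : ℕ → ℝ} {N : ℕ}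
    (hf : DifferentiableOn ℂ f (Metric.ball (0 : ℂ) 1)) (hδ : 0 < δ) (hδ1 : δ ≤ 1 / 2)
    (hK : 1 ≤ K₀) (hB0 : ∀ k, 0 ≤ B k) (hQ : ∀ k ≤ N, δ ^ k * B k ≤ Q)
    (hB : ∀ k ≤ N, ∀ z : ℂ, ‖z‖ ≤ 1 - δ ^ k → ‖f z‖ ≤ Real.exp (B k))
    (h : LowerBoundAtDepth f 1 K₀) :
    LowerBoundAtDepth f (δ ^ N) (2800 ^ N / δ ^ N * (K₀ + N * (Q / δ))) := by
  have hQ0 : 0 ≤ Q := (mul_nonneg (by positivity) (hB0 0)).trans (hQ 0 (Nat.zero_le _))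
  suffices H : ∀ k ≤ N, LowerBoundAtDepth f (δ ^ k) (2800 ^ k / δ ^ k * (K₀ + k * (Q / δ))) from
    H N le_rfl
  intro k
  induction k with
  | zero => intro _; simpa using h
  | succ k ih =>
    intro hk
    have hp : (0 : ℝ) < δ ^ k := by positivity
    have hp1 : δ ^ k ≤ 1 := pow_le_one₀ hδ.le (by linarith)
    have h2 : (1 : ℝ) ≤ 2800 ^ k / δ ^ k := by
      rw [one_le_div hp]
      exact hp1.trans (one_le_pow₀ (by norm_num))
    have hq : 0 ≤ Q / δ := by positivity
    have h1 : 1 ≤ 2800 ^ k / δ ^ k * (K₀ + k * (Q / δ)) := by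
      have : 0 ≤ (k : ℝ) * (Q / δ) := by positivity
      nlinarith
    have hst := (ih (by omega)).step hf hp hp1 hδ hδ1 h1 (hB0 (k + 1))
      (by simpa only [pow_succ] using hB (k + 1) hk)
    rw [← pow_succ] at hst
    have hBk : B (k + 1) ≤ 2800 ^ k / δ ^ k * (Q / δ) := by
      have h3 : B (k + 1) ≤ Q / δ ^ (k + 1) := by
        rw [le_div_iff₀ (by positivity), mul_comm]; exact hQ _ hk
      refine h3.trans ?_
      rw [div_mul_div_comm, ← pow_succ]
      refine div_le_div_of_nonneg_right ?_ (by positivity)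
      exact le_mul_of_one_le_left hQ0 (one_le_pow₀ (by norm_num))
    intro ζ hζ
    obtain ⟨c, hc, hfc⟩ := hst ζ hζ
    refine ⟨c, hc, le_trans (Real.exp_le_exp.2 (neg_le_neg ?_)) hfc⟩
    calc 2800 / δ * (2800 ^ k / δ ^ k * (K₀ + k * (Q / δ)) + B (k + 1))
        ≤ 2800 / δ * (2800 ^ k / δ ^ k * (K₀ + k * (Q / δ)) + 2800 ^ k / δ ^ k * (Q / δ)) := by
          gcongr
      _ = _ := by push_cast; field_simp; ring

/-- Every polar rectangle at level `1 - t` lies well inside a disc about a suitable point of depth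
about `10 t`, whence a bound for the number of zeros. -/
theorem LowerBoundAtDepth.maxZeroCount_le {f : ℂ → ℂ} {t K B : ℝ}
    (hf : DifferentiableOn ℂ f (Metric.ball (0 : ℂ) 1)) (ht : 0 < t) (ht1 : 10 * t ≤ 1)
    (hB0 : 0 ≤ B) (hB : ∀ z : ℂ, ‖z‖ ≤ 1 - t / 4 → ‖f z‖ ≤ Real.exp B)
    (h : LowerBoundAtDepth f (10 * t) K) :
    maxZeroCount f (1 - t) ≤ ENNReal.ofReal ((K + B) / Real.log (965 / 964)) := by
  refine iSup_le fun φ => ?_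
  obtain ⟨c, hc, hfc⟩ := h (Complex.exp (φ * Complex.I)) (Complex.norm_exp_ofReal_mul_I φ)
  have hana : AnalyticOnNhd ℂ f (Metric.ball 0 1) := hf.analyticOnNhd Metric.isOpen_ball
  have hcn : ‖c‖ ≤ 1 - 9.9 * t := by
    have h1 := norm_le_norm_add_norm_sub' c ((1 - 10 * t : ℝ) * Complex.exp (φ * Complex.I))
    rw [norm_mul, Complex.norm_exp_ofReal_mul_I, Complex.norm_real,
      Real.norm_of_nonneg (by linarith)] at h1
    linarith
  have hball : ∀ z ∈ Metric.closedBall c (9.65 * t), ‖z‖ ≤ 1 - t / 4 := by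
    intro z hz
    rw [mem_closedBall_iff_norm] at hz
    have h1 := norm_le_norm_add_norm_sub' z c
    linarith
  -- The rectangle lies within `9.54 t` of the ideal centre and `c` within `0.1 t` of it, which
  -- gives `9.64 t`. Radius `9.65 t` still leaves depth `t / 4`, because `‖c‖ ≤ 1 - 9.9 t`.
  have key := zeroCount_le_of_subset_closedBall (f := f) (c := c) (r := 9.64 * t) (ρ := 9.65 * t)
    (B := B) (K := K) (S := polarRectangle (1 - t) φ) (by positivity) (by linarith)
    (hana.mono fun z hz => by rw [mem_ball_zero_iff]; linarith [hball z hz])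
    (fun z hz => hB z (hball z hz)) hB0 hfc ?_
  · rwa [mul_div_mul_right _ _ ht.ne', show (9.65 : ℝ) / 9.64 = 965 / 964 by norm_num] at key
  · rintro z ⟨s, θ, hs1, hs2, hθ, rfl⟩
    have hsp : ‖(s : ℂ) * Complex.exp (θ * Complex.I) -
        (1 - 10 * t : ℝ) * Complex.exp (φ * Complex.I)‖ ≤ 9.54 * t := by
      have hb : |s - (1 - 10 * t)| ≤ 9.5 * t := by rw [abs_le]; constructor <;> linarith
      have hθ' : |θ - φ| ≤ 0.786 * t := by
        refine hθ.trans ?_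
        have := Real.pi_lt_d4
        nlinarith
      have hsq : ‖(s : ℂ) * Complex.exp (θ * Complex.I) -
          (1 - 10 * t : ℝ) * Complex.exp (φ * Complex.I)‖ ^ 2 =
          (s - (1 - 10 * t)) ^ 2 + 2 * s * (1 - 10 * t) * (1 - Real.cos (θ - φ)) := by
        rw [← Complex.normSq_eq_norm_sq, Complex.normSq_apply, Real.cos_sub]
        simp only [Complex.sub_re, Complex.sub_im, Complex.re_ofReal_mul, Complex.im_ofReal_mul,
          Complex.exp_ofReal_mul_I_re, Complex.exp_ofReal_mul_I_im]
        linear_combination s ^ 2 * Real.sin_sq_add_cos_sq θ +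
          (1 - 10 * t) ^ 2 * Real.sin_sq_add_cos_sq φ
      have hcos := Real.one_sub_sq_div_two_le_cos (x := θ - φ)
      have h1 : (s - (1 - 10 * t)) ^ 2 ≤ (9.5 * t) ^ 2 := sq_le_sq' (abs_le.1 hb).1 (abs_le.1 hb).2
      have h2 : (θ - φ) ^ 2 ≤ (0.786 * t) ^ 2 := sq_le_sq' (abs_le.1 hθ').1 (abs_le.1 hθ').2
      have h3 : 2 * s * (1 - 10 * t) * (1 - Real.cos (θ - φ)) ≤ 2 * (1 - Real.cos (θ - φ)) := by
        have h4 : s * (1 - 10 * t) ≤ 1 := by nlinarith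
        nlinarith [Real.cos_le_one (θ - φ)]
      refine (sq_le_sq₀ (norm_nonneg _) (by positivity)).1 ?_
      rw [hsq]
      nlinarith
    rw [mem_closedBall_iff_norm]
    rw [norm_sub_rev] at hc
    have h5 := norm_sub_le_norm_sub_add_norm_sub ((s : ℂ) * Complex.exp (θ * Complex.I))
      ((1 - 10 * t : ℝ) * Complex.exp (φ * Complex.I)) c
    linarith

/-! ### Upper bounds from the order and from a quasi proximate order -/

theorem norm_le_maxModulus {f : ℂ → ℂ} (hf : DifferentiableOn ℂ f (Metric.ball (0 : ℂ) 1))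
    {r : ℝ} (hr0 : 0 < r) (hr1 : r < 1) {z : ℂ} (hz : ‖z‖ ≤ r) : ‖f z‖ ≤ maxModulus f r := by
  have hsub : Metric.closedBall (0 : ℂ) r ⊆ Metric.ball 0 1 :=
    Metric.closedBall_subset_ball hr1
  have hcont : ContinuousOn f (Metric.closedBall 0 r) := hf.continuousOn.mono hsub
  have hbdd : BddAbove ((fun z => ‖f z‖) '' Metric.sphere (0 : ℂ) r) :=
    (isCompact_sphere (0 : ℂ) r).bddAbove_image
      (hcont.mono Metric.sphere_subset_closedBall).norm
  refine Complex.norm_le_of_forall_mem_frontier_norm_le (U := Metric.ball (0 : ℂ) r)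
    Metric.isBounded_ball ⟨hf.mono (Metric.ball_subset_ball hr1.le), ?_⟩ ?_ ?_
  · rwa [closure_ball _ hr0.ne']
  · intro w hw
    rw [frontier_ball _ hr0.ne'] at hw
    exact le_csSup hbdd ⟨w, hw, rfl⟩
  · rw [closure_ball _ hr0.ne']; simpa using hz

theorem le_exp_of_posLog_le {x y : ℝ} (h : Real.posLog x ≤ y) : x ≤ Real.exp y := by
  rcases le_or_gt x 0 with hx | hx
  · exact hx.trans (Real.exp_pos _).le
  · rw [← Real.log_le_iff_le_exp hx]
    exact (le_max_right _ _).trans h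

theorem log_one_div_one_sub_pos {r : ℝ} (h0 : 0 < r) (h1 : r < 1) :
    0 < Real.log (1 / (1 - r)) :=
  Real.log_pos (by rw [lt_div_iff₀ (by linarith)]; linarith)

theorem exists_ne_zero_of_order_ne_zero {f : ℂ → ℂ} (h : order f ≠ 0) :
    ∃ z ∈ Metric.ball (0 : ℂ) 1, f z ≠ 0 := by
  by_contra! hcon
  refine h ?_
  have : (fun r : ℝ => (growthQuotient f r : EReal)) =ᶠ[𝓝[<] 1] fun _ => 0 := by
    filter_upwards [Ioo_mem_nhdsLT (zero_lt_one' ℝ)] with r hr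
    have hM : maxModulus f r = 0 := by
      have : (fun z => ‖f z‖) '' Metric.sphere (0 : ℂ) r = {0} := by
        refine Set.eq_singleton_iff_nonempty_unique_mem.2
          ⟨(NormedSpace.sphere_nonempty.2 hr.1.le).image _, ?_⟩
        rintro _ ⟨z, hz, rfl⟩
        have hz' : z ∈ Metric.ball (0 : ℂ) 1 := by
          rw [mem_ball_zero_iff, mem_sphere_zero_iff_norm.1 hz]; exact hr.2
        simp [hcon z hz']
      rw [maxModulus, this, csSup_singleton]
    simp [growthQuotient, hM]
  rw [order, limsup_congr this, limsup_const]

theorem exists_norm_le_exp_of_order_lt {f : ℂ → ℂ}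
    (hf : DifferentiableOn ℂ f (Metric.ball (0 : ℂ) 1)) {σ : ℝ} (hσ : 0 < σ)
    (h : order f < (σ : EReal)) :
    ∃ C : ℝ, 1 ≤ C ∧ ∀ z : ℂ, ‖z‖ < 1 → ‖f z‖ ≤ Real.exp (C * (1 / (1 - ‖z‖) ^ σ)) := by
  have hev : ∀ᶠ r in 𝓝[<] (1 : ℝ), maxModulus f r ≤ Real.exp (1 / (1 - r) ^ σ) := by
    filter_upwards [eventually_lt_of_limsup_lt h, Ioo_mem_nhdsLT (zero_lt_one' ℝ)] with r hr hr1
    have hq : growthQuotient f r < σ := by exact_mod_cast hr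
    rw [growthQuotient, div_lt_iff₀ (log_one_div_one_sub_pos hr1.1 hr1.2)] at hq
    refine le_exp_of_posLog_le ((le_exp_of_posLog_le hq.le).trans ?_)
    have hp : 0 < 1 - r := by linarith [hr1.2]
    rw [mul_comm, ← Real.rpow_def_of_pos (by positivity), Real.div_rpow zero_le_one hp.le,
      Real.one_rpow]
  obtain ⟨r₀, hr₀, hr₀'⟩ := (mem_nhdsLT_iff_exists_Ioo_subset' (zero_lt_one' ℝ)).1 hev
  obtain ⟨r₁, hr₁⟩ : ∃ r₁, r₁ = (max r₀ 0 + 1) / 2 := ⟨_, rfl⟩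
  have h0 : max r₀ 0 < 1 := max_lt hr₀ one_pos
  have hr₁0 : 0 < r₁ := by linarith [le_max_right r₀ 0]
  have hr₁1 : r₁ < 1 := by linarith
  have hr₁2 : r₀ < r₁ := by linarith [le_max_left r₀ 0]
  have hp : 0 < 1 - r₁ := by linarith
  have hC : 1 ≤ 1 / (1 - r₁) ^ σ := by
    rw [one_le_div (by positivity)]
    exact Real.rpow_le_one hp.le (by linarith) hσ.le
  refine ⟨1 / (1 - r₁) ^ σ, hC, fun z hz => ?_⟩
  have hz0 := norm_nonneg z
  have hzp : 0 < 1 - ‖z‖ := by linarith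
  rcases le_or_gt ‖z‖ r₁ with hle | hlt
  · refine (norm_le_maxModulus hf hr₁0 hr₁1 hle).trans ((hr₀' ⟨hr₁2, hr₁1⟩).trans ?_)
    refine Real.exp_le_exp.2 (le_mul_of_one_le_right (by positivity) ?_)
    rw [one_le_div (by positivity)]
    exact Real.rpow_le_one hzp.le (by linarith) hσ.le
  · refine (norm_le_maxModulus hf (hr₁0.trans hlt) hz le_rfl).trans
      ((hr₀' ⟨hr₁2.trans hlt, hz⟩).trans ?_)
    exact Real.exp_le_exp.2 (le_mul_of_one_le_left (by positivity) hC)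

theorem tendsto_one_add_div_two :
    Tendsto (fun r : ℝ => (1 + r) / 2) (𝓝[<] 1) (𝓝[<] 1) := by
  refine tendsto_nhdsWithin_iff.2 ⟨?_, ?_⟩
  · have : Tendsto (fun r : ℝ => (1 + r) / 2) (𝓝 1) (𝓝 ((1 + 1) / 2)) :=
      (by fun_prop : Continuous fun r : ℝ => (1 + r) / 2).tendsto 1
    norm_num at this
    exact this.mono_left nhdsWithin_le_nhds
  · filter_upwards [self_mem_nhdsWithin] with r hr
    simp only [mem_Iio] at *
    linarith

/-- Since `1 - (1 - R) / 4` is reached by applying `r ↦ (1 + r) / 2` twice, two doublings of `A`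
bring the bound back to level `R`. -/
theorem IsQuasiProximateOrderWith.eventually_norm_le {f : ℂ → ℂ} {η : ℝ} {lam A : ℝ → ℝ}
    (hf : DifferentiableOn ℂ f (Metric.ball (0 : ℂ) 1))
    (h : IsQuasiProximateOrderWith f η lam A) :
    ∃ C : ℝ, 1 ≤ C ∧ ∀ᶠ R in 𝓝[<] (1 : ℝ), ∀ z : ℂ, ‖z‖ ≤ 1 - (1 - R) / 4 →
      ‖f z‖ ≤ Real.exp (C * (1 / (1 - R) ^ lam R)) := by
  obtain ⟨D, hD⟩ := h.assoc_doubling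
  obtain ⟨δ, hδ, hle⟩ := h.le_assoc
  have hdbl : ∀ r ∈ Ico (0 : ℝ) 1, A ((1 + r) / 2) ≤ max D 1 * A r := fun r hr =>
    (hD r hr).trans (mul_le_mul_of_nonneg_right (le_max_left _ _) (h.assoc_pos r hr).le)
  have hδ1 : ∀ᶠ r in 𝓝[<] (1 : ℝ), δ r ≤ 1 := (hδ.eventually (ge_mem_nhds one_pos))
  have hmax : (1 : ℝ) ≤ max D 1 := le_max_right _ _
  refine ⟨2 * (max D 1 * max D 1), by nlinarith, ?_⟩
  filter_upwards [(tendsto_one_add_div_two.comp tendsto_one_add_div_two).eventually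
    (hle.and hδ1), h.assoc_le, Ioo_mem_nhdsLT (zero_lt_one' ℝ)] with R hR1 hA hR z hz
  simp only [Function.comp_apply] at hR1
  have hr : 1 - (1 - R) / 4 = (1 + (1 + R) / 2) / 2 := by ring
  rw [hr] at hz
  have hRI : R ∈ Ico (0 : ℝ) 1 := ⟨hR.1.le, hR.2⟩
  have hRI2 : (1 + R) / 2 ∈ Ico (0 : ℝ) 1 := ⟨by linarith [hR.1], by linarith [hR.2]⟩
  have hRI3 : (1 + (1 + R) / 2) / 2 ∈ Ico (0 : ℝ) 1 := ⟨by linarith [hR.1], by linarith [hR.2]⟩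
  have hfz := norm_le_maxModulus hf (by linarith [hR.1]) hRI3.2 hz
  rcases eq_or_lt_of_le (norm_nonneg (f z)) with h0 | h0
  · rw [← h0]; positivity
  rw [← Real.log_le_iff_le_exp h0]
  calc Real.log ‖f z‖ ≤ Real.log (maxModulus f ((1 + (1 + R) / 2) / 2)) :=
        Real.log_le_log h0 hfz
    _ ≤ _ := h.log_maxModulus_le _ hRI3
    _ ≤ _ := hR1.1
    _ ≤ 2 * A ((1 + (1 + R) / 2) / 2) :=
        mul_le_mul_of_nonneg_right (by linarith [hR1.2]) (h.assoc_pos _ hRI3).le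
    _ ≤ 2 * (max D 1 * (max D 1 * A R)) := by
        gcongr
        exact (hdbl _ hRI2).trans (by gcongr; exact hdbl _ hRI)
    _ ≤ 2 * (max D 1 * (max D 1 * (1 / (1 - R) ^ lam R))) := by gcongr
    _ = _ := by ring

/-! ### Balancing the two upper bounds and counting zeros -/

/-- For `σ > 1` the two terms cross at `s = T ^ (-1 / σ)`, where the product is largest; for `σ ≤ 1`
it never exceeds 1. -/
theorem mul_min_rpow_le {s σ T : ℝ} (hs : 0 < s) (hs1 : s ≤ 1) (hσ : 0 < σ) (hT : 1 ≤ T) :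
    s * min (1 / s ^ σ) T ≤ T ^ max (1 - 1 / σ) 0 := by
  have hT0 : 0 < T := by linarith
  have e : s * (1 / s ^ σ) = s ^ (1 - σ) := by
    rw [Real.rpow_sub hs, Real.rpow_one]; ring
  rcases le_or_gt σ 1 with h | h
  · calc s * min (1 / s ^ σ) T ≤ s * (1 / s ^ σ) := by gcongr; exact min_le_left _ _
      _ ≤ 1 := by rw [e]; exact Real.rpow_le_one hs.le hs1 (by linarith)
      _ ≤ _ := Real.one_le_rpow hT (le_max_right _ _)
  · have h1 : 0 ≤ 1 - 1 / σ := by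
      rw [sub_nonneg, div_le_one hσ]; exact h.le
    rw [max_eq_left h1]
    rcases le_total s (T ^ (-(1 / σ))) with hsT | hsT
    · calc s * min (1 / s ^ σ) T ≤ T ^ (-(1 / σ)) * T := by gcongr; exact min_le_right _ _
        _ = _ := by rw [← Real.rpow_add_one hT0.ne']; ring_nf
    · calc s * min (1 / s ^ σ) T ≤ s * (1 / s ^ σ) := by gcongr; exact min_le_left _ _
        _ ≤ (T ^ (-(1 / σ))) ^ (1 - σ) := by
            rw [e]; exact Real.rpow_le_rpow_of_nonpos (by positivity) hsT (by linarith)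
        _ = _ := by
            rw [← Real.rpow_mul hT0.le]; congr 1; field_simp; ring

theorem one_div_rpow_le_one_div_rpow {t p q : ℝ} (ht : 0 < t) (ht1 : t ≤ 1) (h : p ≤ q) :
    1 / t ^ p ≤ 1 / t ^ q :=
  one_div_le_one_div_of_le (by positivity) (Real.rpow_le_rpow_of_exponent_ge ht ht1 h)

theorem eventually_maxZeroCount_le {f : ℂ → ℂ}
    (hf : DifferentiableOn ℂ f (Metric.ball (0 : ℂ) 1)) {sM η ε : ℝ} {lam A : ℝ → ℝ}
    (hsM : order f = (sM : EReal)) (hsM0 : 0 < sM) (h : IsQuasiProximateOrderWith f η lam A)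
    (hε : 0 < ε) :
    ∃ C : ℝ, 0 < C ∧ ∀ᶠ R in 𝓝[<] (1 : ℝ), maxZeroCount f R ≤
      ENNReal.ofReal (C * (1 / (1 - R) ^ (1 + lam R * max (1 - 1 / sM) 0 + ε))) := by
  -- Eventually `lam R ≤ σ`, so replacing `sM` by `σ` costs at most `σ (1 / sM - 1 / σ) = ε / 2` in
  -- the exponent. The other `ε / 2` pays for `1 / N`.
  obtain ⟨σ, hσ⟩ : ∃ σ, σ = sM + sM * ε / 2 := ⟨_, rfl⟩
  have hσlt : sM < σ := by have := mul_pos hsM0 hε; linarith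
  have hσ0 : 0 < σ := hsM0.trans hσlt
  have hlt : order f < (σ : EReal) := by rw [hsM]; exact_mod_cast hσlt
  obtain ⟨z₀, hz₀, hfz₀⟩ := exists_ne_zero_of_order_ne_zero (f := f) (by
    rw [hsM]; exact_mod_cast hsM0.ne')
  obtain ⟨K, hK, hbase⟩ := exists_lowerBoundAtDepth_one hf hz₀ hfz₀
  obtain ⟨C₁, hC₁, hf₁⟩ := exists_norm_le_exp_of_order_lt hf hσ0 hlt
  obtain ⟨C₂, hC₂, hf₂⟩ := h.eventually_norm_le hf
  obtain ⟨C, hCC₁, hCC₂⟩ : ∃ C, C₁ ≤ C ∧ C₂ ≤ C := ⟨_, le_max_left _ _, le_max_right _ _⟩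
  have hC0 : 0 < C := by linarith
  obtain ⟨N, hN⟩ := exists_nat_gt (2 / ε)
  have hN0 : (0 : ℝ) < N := (by positivity : (0 : ℝ) < 2 / ε).trans hN
  have hN0' : N ≠ 0 := by rintro rfl; simp at hN0
  have hNε : 1 / (N : ℝ) ≤ ε / 2 := by
    rw [div_lt_iff₀ hε] at hN
    rw [div_le_div_iff₀ hN0 two_pos]; linarith
  have hL : 0 < Real.log (965 / 964) := Real.log_pos (by norm_num)
  have hlam : ∀ᶠ R in 𝓝[<] (1 : ℝ), lam R ≤ σ := by
    filter_upwards [eventually_lt_of_limsup_lt (h.limsup_eq.trans_lt hlt)] with R hR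
    exact (by exact_mod_cast hR : lam R < σ).le
  have hsmall : ∀ᶠ R in 𝓝[<] (1 : ℝ), 10 * (1 - R) ≤ (1 / 2) ^ N := by
    have h0 : Tendsto (fun R : ℝ => 10 * (1 - R)) (𝓝[<] 1) (𝓝 (10 * (1 - 1))) :=
      ((by fun_prop : Continuous fun R : ℝ => 10 * (1 - R)).tendsto 1).mono_left
        nhdsWithin_le_nhds
    exact h0.eventually (ge_mem_nhds (by norm_num))
  refine ⟨(2800 ^ N * (K + N * C) + C) / Real.log (965 / 964), by positivity, ?_⟩
  filter_upwards [hf₂, hlam, hsmall, Ioo_mem_nhdsLT (zero_lt_one' ℝ)] with R hR₂ hRlam hRs hR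
  obtain ⟨t, ht⟩ : ∃ t, t = 1 - R := ⟨_, rfl⟩
  have hRt : R = 1 - t := by linarith
  rw [← ht] at hR₂ hRs ⊢
  have ht0 : 0 < t := by linarith [hR.2]
  have ht10 : 10 * t ≤ 1 := hRs.trans (pow_le_one₀ (by norm_num) (by norm_num))
  have ht1 : t ≤ 1 := by linarith
  have hl0 : 0 < lam R := h.lam_pos R ⟨hR.1.le, hR.2⟩
  -- Chosen so that exactly `N` steps from depth 1 end at depth `10 t`, as the counting lemma needs.
  obtain ⟨δ, hδ⟩ : ∃ δ, δ = (10 * t) ^ (1 / (N : ℝ)) := ⟨_, rfl⟩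
  have hδ0 : 0 < δ := by rw [hδ]; positivity
  have hδN : δ ^ N = 10 * t := by
    rw [hδ, one_div, Real.rpow_inv_natCast_pow (by positivity) hN0']
  have hδ1 : δ ≤ 1 / 2 := by
    refine le_of_pow_le_pow_left₀ hN0' (by norm_num) ?_
    rw [hδN]; exact hRs
  obtain ⟨T, hT⟩ : ∃ T, T = 1 / t ^ lam R := ⟨_, rfl⟩
  rw [← hT] at hR₂
  have hT1 : 1 ≤ T := by
    rw [hT, one_le_div (by positivity)]
    exact Real.rpow_le_one ht0.le ht1 hl0.le
  have hdepth : ∀ k ≤ N, 10 * t ≤ δ ^ k := fun k hk => by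
    rw [← hδN]; exact pow_le_pow_of_le_one hδ0.le (by linarith) hk
  have hiter := hbase.iterate (B := fun k => C * min (1 / (δ ^ k) ^ σ) T) (N := N)
    (Q := C * T ^ max (1 - 1 / σ) 0) hf hδ0 hδ1 hK
    (fun k => by have : 0 < (δ ^ k) ^ σ := by positivity
                 positivity)
    (fun k _ => by
      have := mul_min_rpow_le (s := δ ^ k) (by positivity) (pow_le_one₀ hδ0.le (by linarith))
        hσ0 hT1
      calc δ ^ k * (C * min (1 / (δ ^ k) ^ σ) T) = C * (δ ^ k * min (1 / (δ ^ k) ^ σ) T) := by ring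
        _ ≤ _ := by gcongr)
    (fun k hk z hz => by
      have hd := hdepth k hk
      have hdp : 0 < δ ^ k := by positivity
      rw [mul_min_of_nonneg _ _ hC0.le, Real.exp_monotone.map_min]
      refine le_min ((hf₁ z (by linarith)).trans (Real.exp_le_exp.2 ?_))
        ((hR₂ z (by linarith)).trans (Real.exp_le_exp.2 ?_))
      · have hz1 : 0 < 1 - ‖z‖ := by linarith
        gcongr
        linarith
      · gcongr)
  rw [hδN] at hiter
  have hcount := hiter.maxZeroCount_le (B := C * T) hf ht0 ht10 (by positivity)
    (fun z hz => (hR₂ z hz).trans (Real.exp_le_exp.2 (by gcongr)))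
  rw [← hRt] at hcount
  refine hcount.trans (ENNReal.ofReal_le_ofReal ?_)
  rw [div_mul_eq_mul_div _ (Real.log _)]
  refine div_le_div_of_nonneg_right ?_ hL.le
  obtain ⟨α, hα⟩ : ∃ α, α = max (1 - 1 / sM) 0 := ⟨_, rfl⟩
  have hα0 : 0 ≤ α := hα ▸ le_max_right _ _
  have hα1 : 1 - 1 / sM ≤ α := hα ▸ le_max_left _ _
  rw [← hα]
  have hσs : σ / sM = 1 + ε / 2 := by rw [hσ]; field_simp
  have hlα : lam R * max (1 - 1 / σ) 0 ≤ lam R * α + ε / 2 := by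
    have h1 : max (1 - 1 / σ) 0 ≤ α + (1 / sM - 1 / σ) := by
      have : 1 / σ ≤ 1 / sM := one_div_le_one_div_of_le hsM0 hσlt.le
      exact max_le (by linarith) (by linarith)
    have h2 : lam R * (1 / sM - 1 / σ) ≤ ε / 2 := by
      have h3 : σ * (1 / sM - 1 / σ) = ε / 2 := by
        rw [mul_sub, mul_one_div, hσs, mul_one_div_cancel hσ0.ne']; ring
      rw [← h3]
      have : 1 / σ ≤ 1 / sM := one_div_le_one_div_of_le hsM0 hσlt.le
      exact mul_le_mul_of_nonneg_right hRlam (by linarith)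
    nlinarith
  have hlam1 : lam R ≤ 1 + lam R * α + ε := by
    have h1 : lam R * (1 / sM) ≤ 1 + ε / 2 := by
      rw [← hσs, mul_one_div]
      exact div_le_div_of_nonneg_right hRlam hsM0.le
    nlinarith
  have hlα0 : 0 ≤ lam R * α := by positivity
  obtain ⟨P, hP⟩ : ∃ P, P = 1 / t ^ (1 + lam R * α + ε) := ⟨_, rfl⟩
  have hP1 : 1 / (10 * t) ≤ P := by
    have h1 := one_div_rpow_le_one_div_rpow ht0 ht1
      (by linarith : 1 ≤ 1 + lam R * α + ε)
    rw [Real.rpow_one, ← hP] at h1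
    exact (one_div_le_one_div_of_le ht0 (by linarith)).trans h1
  have hPT : T ≤ P := by rw [hT, hP]; exact one_div_rpow_le_one_div_rpow ht0 ht1 hlam1
  have hPQ : 1 / (10 * t) * (T ^ max (1 - 1 / σ) 0 / δ) ≤ P := by
    have h1 : T ^ max (1 - 1 / σ) 0 = 1 / t ^ (lam R * max (1 - 1 / σ) 0) := by
      rw [hT, Real.div_rpow zero_le_one (by positivity), Real.one_rpow, ← Real.rpow_mul ht0.le]
    have h2 : t ^ (1 / (N : ℝ)) ≤ δ := by
      rw [hδ]; exact Real.rpow_le_rpow ht0.le (by linarith) (by positivity)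
    calc 1 / (10 * t) * (T ^ max (1 - 1 / σ) 0 / δ)
        ≤ 1 / t * (1 / t ^ (lam R * max (1 - 1 / σ) 0) / t ^ (1 / (N : ℝ))) := by
          rw [h1]; gcongr; linarith
      _ = 1 / t ^ (1 + lam R * max (1 - 1 / σ) 0 + 1 / (N : ℝ)) := by
          rw [Real.rpow_add ht0, Real.rpow_add ht0, Real.rpow_one]; field_simp
      _ ≤ P := by
          rw [hP]
          exact one_div_rpow_le_one_div_rpow ht0 ht1 (by linarith)
  rw [← hP]
  calc 2800 ^ N / (10 * t) * (K + N * (C * T ^ max (1 - 1 / σ) 0 / δ)) + C * T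
      = 2800 ^ N * (K * (1 / (10 * t)) +
          N * C * (1 / (10 * t) * (T ^ max (1 - 1 / σ) 0 / δ))) + C * T := by ring
    _ ≤ 2800 ^ N * (K * P + N * C * P) + C * P := by gcongr
    _ = _ := by ring

/-! ### Upper density and slow variation -/

theorem upperDensity_le_one (E : Set ℝ) : upperDensity E ≤ 1 := by
  refine limsup_le_of_le (by isBoundedDefault) (Eventually.of_forall fun r => ?_)
  refine ENNReal.div_le_of_le_mul ?_
  rw [one_mul, ← Real.volume_Ico]
  exact measure_mono inter_subset_right

theorem one_le_upperDensity {E : Set ℝ}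
    (h : ∀ q : ℝ, 0 < q → q < 1 → ∃ᶠ r in 𝓝[<] (1 : ℝ), Ico r (1 - q * (1 - r)) ⊆ E) :
    1 ≤ upperDensity E := by
  refine le_of_forall_lt fun c hc => ?_
  obtain ⟨d, hcd, hd1⟩ := exists_between hc
  refine hcd.trans_le (le_limsup_of_frequently_le ?_ (by isBoundedDefault))
  have hd : d ≠ ⊤ := (hd1.trans ENNReal.one_lt_top).ne
  have hd0 : 0 < d.toReal := ENNReal.toReal_pos (bot_le.trans_lt hcd).ne' hd
  have hd1' : d.toReal < 1 := by
    rw [← ENNReal.toReal_one]; exact (ENNReal.toReal_lt_toReal hd ENNReal.one_ne_top).2 hd1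
  -- With `q = 1 - d`, the interval `[r, 1 - q (1 - r))` has length `d (1 - r)`.
  refine ((h (1 - d.toReal) (by linarith) (by linarith)).and_eventually
    self_mem_nhdsWithin).mono ?_
  rintro r ⟨hr, hr1⟩
  have hr1 : 0 < 1 - r := sub_pos.2 hr1
  rw [ENNReal.le_div_iff_mul_le (Or.inl (by simpa using hr1)) (Or.inl ENNReal.ofReal_ne_top)]
  calc d * ENNReal.ofReal (1 - r)
      = volume (Ico r (1 - (1 - d.toReal) * (1 - r))) := by
        rw [Real.volume_Ico]
        conv_lhs => rw [← ENNReal.ofReal_toReal hd, ← ENNReal.ofReal_mul hd0.le]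
        congr 1; ring
    _ ≤ _ := measure_mono (subset_inter hr (Ico_subset_Ico_right (by nlinarith)))

theorem tendsto_log_one_div_one_sub :
    Tendsto (fun r : ℝ => Real.log (1 / (1 - r))) (𝓝[<] 1) atTop := by
  have h : Tendsto (fun r : ℝ => 1 - r) (𝓝[<] 1) (𝓝[>] 0) := by
    refine tendsto_nhdsWithin_iff.2 ⟨?_, ?_⟩
    · have : Tendsto (fun r : ℝ => 1 - r) (𝓝 1) (𝓝 (1 - 1)) :=
        (by fun_prop : Continuous fun r : ℝ => 1 - r).tendsto 1
      rw [sub_self] at this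
      exact this.mono_left nhdsWithin_le_nhds
    · filter_upwards [self_mem_nhdsWithin] with r hr using sub_pos.2 (mem_Iio.1 hr)
  simp only [one_div]
  exact Real.tendsto_log_atTop.comp (tendsto_inv_nhdsGT_zero.comp h)

/-- A quasi proximate order varies slowly. -/
theorem IsQuasiProximateOrderWith.eventually_le_add {f : ℂ → ℂ} {η : ℝ} {lam A : ℝ → ℝ}
    (h : IsQuasiProximateOrderWith f η lam A) {q ε : ℝ} (hq : 0 < q) (hε : 0 < ε) :
    ∀ᶠ r in 𝓝[<] (1 : ℝ), ∀ x ∈ Ico r (1 - q * (1 - r)), lam x ≤ lam r + ε := by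
  obtain ⟨D, hD, -⟩ := EReal.lt_iff_exists_real_btwn.1 h.limsup_deriv_lt_top
  have hD' : ∀ᶠ r in 𝓝[<] (1 : ℝ),
      |deriv lam r| * (1 - r) * Real.log (1 / (1 - r)) ≤ max D 0 := by
    filter_upwards [eventually_lt_of_limsup_lt hD] with r hr
    exact (EReal.coe_lt_coe_iff.1 hr).le.trans (le_max_left _ _)
  obtain ⟨r₀, hr₀, hr₀'⟩ := (mem_nhdsLT_iff_exists_Ioo_subset' (zero_lt_one' ℝ)).1 hD'
  filter_upwards [Ioo_mem_nhdsLT (max_lt hr₀ one_pos),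
    tendsto_log_one_div_one_sub.eventually_ge_atTop (max D 0 / (q * ε))] with r hr hlog x hx
  have hr1 : r < 1 := hr.2
  have hr0 : 0 < r := (le_max_right _ _).trans_lt hr.1
  have hrr₀ : r₀ < r := (le_max_left _ _).trans_lt hr.1
  have hp : 0 < 1 - r := sub_pos.2 hr1
  have hlogp := log_one_div_one_sub_pos hr0 hr1
  -- On this interval `1 - y ≥ q (1 - r)`, so the derivative condition gives `|lam'| ≤ D / (q (1 -
  -- r) log (1 / (1 - r)))`; the logarithm eventually absorbs `D / (q ε)`.
  have hbound : ∀ y ∈ Ico r (1 - q * (1 - r)), DifferentiableAt ℝ lam y ∧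
      ‖deriv lam y‖ ≤ ε / (1 - r) := by
    intro y hy
    have hqp : 0 < q * (1 - r) := by positivity
    have hy1 : y < 1 := by linarith [hy.2]
    have hyp : 0 < 1 - y := sub_pos.2 hy1
    refine ⟨((h.contDiffOn.differentiableOn one_ne_zero) y ⟨by linarith [hy.1], hy1⟩).differentiableAt
      (Ico_mem_nhds (by linarith [hy.1]) hy1), ?_⟩
    have h1 : |deriv lam y| * (1 - y) * Real.log (1 / (1 - y)) ≤ max D 0 :=
      hr₀' ⟨hrr₀.trans_le hy.1, hy1⟩
    have h2 : Real.log (1 / (1 - r)) ≤ Real.log (1 / (1 - y)) :=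
      Real.log_le_log (by positivity) (one_div_le_one_div_of_le hyp (by linarith [hy.1]))
    have h3 : |deriv lam y| * (q * (1 - r)) * Real.log (1 / (1 - r)) ≤ max D 0 := by
      refine le_trans ?_ h1
      gcongr
      linarith [hy.2]
    rw [div_le_iff₀ (by positivity)] at hlog
    rw [Real.norm_eq_abs, le_div_iff₀ hp]
    have h4 : |deriv lam y| * (q * (1 - r)) * Real.log (1 / (1 - r)) ≤
        Real.log (1 / (1 - r)) * (q * ε) := h3.trans hlog
    refine le_of_mul_le_mul_right ?_ (mul_pos hlogp hq)
    linarith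
  have hrI : r ∈ Ico r (1 - q * (1 - r)) := ⟨le_rfl, hx.1.trans_lt hx.2⟩
  have hmv := (convex_Ico r (1 - q * (1 - r))).norm_image_sub_le_of_norm_deriv_le
    (fun y hy => (hbound y hy).1) (fun y hy => (hbound y hy).2) hrI hx
  rw [Real.norm_eq_abs, Real.norm_eq_abs, abs_of_nonneg (sub_nonneg.2 hx.1)] at hmv
  have h5 : ε / (1 - r) * (x - r) ≤ ε := by
    rw [div_mul_eq_mul_div, div_le_iff₀ hp]
    have : 0 < q * (1 - r) := by positivity
    exact mul_le_mul_of_nonneg_left (by linarith [hx.2]) hε.le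
  linarith [le_abs_self (lam x - lam r)]

/-- Points with `lam r < m + ε / 2` accumulate at 1, and slow variation spends the other `ε / 2` on
the interval following each of them. -/
theorem IsQuasiProximateOrderWith.upperDensity_sublevel {f : ℂ → ℂ} {η m r₁ ε : ℝ}
    {lam A : ℝ → ℝ} (h : IsQuasiProximateOrderWith f η lam A)
    (hm : liminf (fun r : ℝ => (lam r : EReal)) (𝓝[<] 1) = (m : EReal)) (hr₁ : r₁ < 1)
    (hε : 0 < ε) :
    upperDensity {R | R ∈ Ico (0 : ℝ) 1 ∧ r₁ < R ∧ lam R ≤ m + ε} = 1 := by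
  refine le_antisymm (upperDensity_le_one _) (one_le_upperDensity fun q hq hq1 => ?_)
  have hfreq : ∃ᶠ r in 𝓝[<] (1 : ℝ), lam r < m + ε / 2 := by
    have hlt : liminf (fun r : ℝ => (lam r : EReal)) (𝓝[<] 1) < ((m + ε / 2 : ℝ) : EReal) := by
      rw [hm]
      exact EReal.coe_lt_coe_iff.2 (by linarith)
    exact (frequently_lt_of_liminf_lt (by isBoundedDefault) hlt).mono fun r hr =>
      EReal.coe_lt_coe_iff.1 hr
  refine (hfreq.and_eventually ((h.eventually_le_add hq (half_pos hε)).and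
    (Ioo_mem_nhdsLT (max_lt hr₁ one_pos)))).mono ?_
  rintro r ⟨hr, hle, hr'⟩ x hx
  have hp : 0 < q * (1 - r) := mul_pos hq (sub_pos.2 hr'.2)
  exact ⟨⟨(le_max_right r₁ 0).trans (hr'.1.le.trans hx.1), by linarith [hx.2]⟩,
    (le_max_left r₁ 0).trans_lt (hr'.1.trans_le hx.1), by linarith [hle x hx]⟩

end UnitDisc

/-! ### The main theorem -/

theorem mainTheorem6 (f : ℂ → ℂ) (hf : DifferentiableOn ℂ f (Metric.ball (0 : ℂ) 1))
    (lM sM : ℝ) (hlM : UnitDisc.lowerOrder f = (lM : EReal))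
    (hsM : UnitDisc.order f = (sM : EReal)) (hl0 : 0 ≤ lM) (hls : lM < sM)
    (η : ℝ) (hη0 : 0 < η) (hη1 : η < sM - lM)
    (lam : ℝ → ℝ) (hlam : UnitDisc.IsQuasiProximateOrder f η lam)
    (ε : ℝ) (hε : 0 < ε) :
    (∃ C : ℝ, 0 < C ∧ ∀ᶠ R in 𝓝[<] (1 : ℝ),
      UnitDisc.maxZeroCount f R ≤
        ENNReal.ofReal (C * (1 / (1 - R) ^ (1 + lam R * max (1 - 1 / sM) 0 + ε)))) ∧
    (∃ E : Set ℝ, E ⊆ Ico 0 1 ∧ MeasurableSet E ∧ UnitDisc.upperDensity E = 1 ∧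
      ∃ C : ℝ, 0 < C ∧ ∀ R ∈ E,
        UnitDisc.maxZeroCount f R ≤
          ENNReal.ofReal (C * (1 / (1 - R) ^ (1 + (lM + η) * max (1 - 1 / sM) 0 + ε)))) := by
  obtain ⟨A, hA⟩ := hlam
  have hsM0 : 0 < sM := hl0.trans_lt hls
  refine ⟨UnitDisc.eventually_maxZeroCount_le hf hsM hsM0 hA hε, ?_⟩
  -- Half of `ε` is reserved for the slack in `lam R ≤ lM + η + ε / 2`, which is multiplied by a
  -- factor at most 1. Cutting the set at `r₁` makes the eventual bound hold throughout it.
  obtain ⟨C, hC, hev⟩ := UnitDisc.eventually_maxZeroCount_le hf hsM hsM0 hA (half_pos hε)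
  obtain ⟨r₁, hr₁, hr₁'⟩ := (mem_nhdsLT_iff_exists_Ioo_subset' (zero_lt_one' ℝ)).1 hev
  have hliminf : liminf (fun r : ℝ => (lam r : EReal)) (𝓝[<] 1) = ((lM + η : ℝ) : EReal) := by
    rw [hA.liminf_eq, hlM]; norm_cast
  refine ⟨{R | R ∈ Ico (0 : ℝ) 1 ∧ r₁ < R ∧ lam R ≤ lM + η + ε / 2}, fun R hR => hR.1, ?_,
    hA.upperDensity_sublevel hliminf hr₁ (half_pos hε), C, hC, ?_⟩
  · obtain ⟨u, hu, hu'⟩ := continuousOn_iff_isClosed.1 hA.contDiffOn.continuousOn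
      (Iic (lM + η + ε / 2)) isClosed_Iic
    have : {R | R ∈ Ico (0 : ℝ) 1 ∧ r₁ < R ∧ lam R ≤ lM + η + ε / 2} =
        (u ∩ Ico 0 1) ∩ Ioi r₁ := by
      rw [← hu']; ext R; simp only [mem_ofPred_eq, mem_inter_iff, mem_preimage, mem_Iic, mem_Ioi]
      tauto
    rw [this]
    exact (hu.measurableSet.inter measurableSet_Ico).inter measurableSet_Ioi
  · rintro R ⟨hR, hRr, hRl⟩
    refine (hr₁' ⟨hRr, hR.2⟩).trans (ENNReal.ofReal_le_ofReal ?_)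
    refine mul_le_mul_of_nonneg_left (UnitDisc.one_div_rpow_le_one_div_rpow (sub_pos.2 hR.2)
      (by linarith [hR.1]) ?_) hC.le
    have hα0 : 0 ≤ max (1 - 1 / sM) 0 := le_max_right _ _
    have hα1 : max (1 - 1 / sM) 0 ≤ 1 :=
      max_le (by linarith [one_div_pos.2 hsM0]) zero_le_one
    nlinarith
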